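/- Let $A$ and $B$ be finite-dimensional quantum systems with full-rank thermal states $\gamma_A$ and $\gamma_B$ (positive definite density matrices). For linear maps $\Phi,\Psi$ from operators on $A$ to operators on $B$ write $\Phi\le\Psi$ if $\Psi-\Phi$ is completely positive. A channel is a completely positive trace-preserving linear map. Let $\mathrm{GPO}$ be the set of channels $G$ from $A$ to $B$ with $G(\gamma_A)=\gamma_B$, let $\mathrm{NSO}$ be the set of maps $\Phi_\sigma(\cdot)=\mathrm{Tr}\{\cdot\}\,\sigma$ with $\sigma$ a state of $B$, and let $\Gamma(\cdot)=\mathrm{Tr}\{\cdot\}\,\gamma_B$. For a channel $\Lambda$ from $A$ to $B$ put $$R(\Lambda\|\Gamma)=\min\{s\in\mathbb R:\Lambda\le(1+s)\Gamma\},$$ $$R_{\mathrm T}(\Lambda)=\min\{s\in\mathbb R:\Lambda\le(1+s)G,\ G\in\mathrm{GPO}\},\qquad R_{\mathrm S}(\Lambda)=\min\{s\in\mathbb R:\Lambda\le(1+s)\Phi,\ \Phi\in\mathrm{NSO}\}.$$ Then, for every channel $\Lambda$ from $A$ to $B$, these three minima exist and $$R(\Lambda\|\Gamma)\ \ge\ R_{\mathrm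 S}(\Lambda)\ \ge\ 2\left(g_{\min}^{(AB)}\right)^2\left[R(\Lambda\|\Gamma)-R_{\mathrm T}(\Lambda)\right]^2,$$ where $g_{\min}^{(AB)}$ is the smallest eigenvalue of $\gamma_A\otimes\gamma_B$. In particular, for every $G\in\mathrm{GPO}$, with $P_{\mathrm T}(G):=R(G\|\Gamma)$, $$P_{\mathrm T}(G)\ \ge\ R_{\mathrm S}(G)\ \ge\ 2\left(g_{\min}^{(AB)}\right)^2P_{\mathrm T}(G)^2.$$ -/

import Mathlib

open scoped ComplexOrder Kronecker

noncomputable section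

namespace Athermality

/-- `ρ` is a quantum state (density matrix) of the finite-dimensional system with orthonormal
basis indexed by `n`. -/
def IsState {n : Type*} [Fintype n] (ρ : Matrix n n ℂ) : Prop :=
  ρ.PosSemidef ∧ ρ.trace = 1

/-- `γ` is a full-rank thermal state. Every full-rank density matrix is the Gibbs state of some
Hamiltonian, so these are exactly the full-rank density matrices. -/
def IsThermalState {n : Type*} [Fintype n] (γ : Matrix n n ℂ) : Prop :=
  γ.PosDef ∧ γ.trace = 1

section Maps

variable {A B : Type*}

/-- The map `id ⊗ Φ`, applied blockwise to an operator on the composite of an ancilla with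
basis `r` and the input system. -/
def ampliate {r : Type*} (Φ : Matrix A A ℂ →ₗ[ℂ] Matrix B B ℂ)
    (X : Matrix (r × A) (r × A) ℂ) : Matrix (r × B) (r × B) ℂ :=
  Matrix.of fun p q => Φ (Matrix.of fun a a' => X (p.1, a) (q.1, a')) p.2 q.2

variable [Fintype A] [Fintype B]

/-- Complete positivity. -/
def IsCompletelyPositive (Φ : Matrix A A ℂ →ₗ[ℂ] Matrix B B ℂ) : Prop :=
  ∀ (k : ℕ) (X : Matrix (Fin k × A) (Fin k × A) ℂ), X.PosSemidef → (ampliate Φ X).PosSemidef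

/-- Quantum channels from `A` to `B`: completely positive trace-preserving linear maps. -/
def IsChannel (Φ : Matrix A A ℂ →ₗ[ℂ] Matrix B B ℂ) : Prop :=
  IsCompletelyPositive Φ ∧ ∀ X, (Φ X).trace = X.trace

/-- The order on linear maps: `Φ ≤ Ψ` iff `Ψ - Φ` is completely positive. -/
def CPLE (Φ Ψ : Matrix A A ℂ →ₗ[ℂ] Matrix B B ℂ) : Prop :=
  IsCompletelyPositive (Ψ - Φ)

/-- The Gibbs-preserving operations. -/
def GPO (γA : Matrix A A ℂ) (γB : Matrix B B ℂ) : Set (Matrix A A ℂ →ₗ[ℂ] Matrix B B ℂ) :=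
  {G | IsChannel G ∧ G γA = γB}

/-- The trace-and-replace map `X ↦ Tr(X) σ`. -/
def traceReplace (A : Type*) [Fintype A] {B : Type*} (σ : Matrix B B ℂ) :
    Matrix A A ℂ →ₗ[ℂ] Matrix B B ℂ :=
  (Matrix.traceLinearMap A ℂ ℂ).smulRight σ

/-- The non-signalling operations from `A` to `B`. -/
def NSO (A B : Type*) [Fintype A] [Fintype B] : Set (Matrix A A ℂ →ₗ[ℂ] Matrix B B ℂ) :=
  {Φ | ∃ σ : Matrix B B ℂ, IsState σ ∧ Φ = traceReplace A σ}

/-- All `s` with `Λ ≤ (1 + s) Ω`. -/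
def feasible (Λ Ω : Matrix A A ℂ →ₗ[ℂ] Matrix B B ℂ) : Set ℝ :=
  {s | CPLE Λ (((1 + s : ℝ) : ℂ) • Ω)}

/-- All `s` with `Λ ≤ (1 + s) Z` for some free operation `Z ∈ F`. -/
def feasibleFree (F : Set (Matrix A A ℂ →ₗ[ℂ] Matrix B B ℂ))
    (Λ : Matrix A A ℂ →ₗ[ℂ] Matrix B B ℂ) : Set ℝ :=
  {s | ∃ Z ∈ F, CPLE Λ (((1 + s : ℝ) : ℂ) • Z)}

/-- The completely thermalising channel `Γ(X) = Tr(X) γB`. -/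
def thermalising (A : Type*) [Fintype A] {B : Type*} (γB : Matrix B B ℂ) :
    Matrix A A ℂ →ₗ[ℂ] Matrix B B ℂ :=
  traceReplace A γB

/-- The joint measure `R(Λ‖Γ)` of signalling and athermality. -/
def jointRobustness (γB : Matrix B B ℂ) (Λ : Matrix A A ℂ →ₗ[ℂ] Matrix B B ℂ) : ℝ :=
  sInf (feasible Λ (thermalising A γB))

/-- The robustness of athermality `R_T(Λ)`. -/
def athermalityRobustness (γA : Matrix A A ℂ) (γB : Matrix B B ℂ)
    (Λ : Matrix A A ℂ →ₗ[ℂ] Matrix B B ℂ) : ℝ :=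
  sInf (feasibleFree (GPO γA γB) Λ)

/-- The robustness of signalling `R_S(Λ)`. -/
def signallingRobustness (Λ : Matrix A A ℂ →ₗ[ℂ] Matrix B B ℂ) : ℝ :=
  sInf (feasibleFree (NSO A B) Λ)

/-- The athermality preservability `P_T(G) = R(G‖Γ)` of a Gibbs-preserving operation `G`. -/
def athermalityPreservability (γA : Matrix A A ℂ) (γB : Matrix B B ℂ) (G : GPO γA γB) : ℝ :=
  jointRobustness γB G.1

end Maps

/-- The smallest eigenvalue of a Hermitian matrix. -/
def minEigenvalue {n : Type*} [Fintype n] [DecidableEq n] {M : Matrix n n ℂ}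
    (hM : M.IsHermitian) : ℝ :=
  ⨅ i, hM.eigenvalues i

/-- The thermal state `γA ⊗ γB` of the composite system is Hermitian. -/
theorem IsThermalState.kronecker_isHermitian {A B : Type*} [Fintype A] [Fintype B]
    {γA : Matrix A A ℂ} {γB : Matrix B B ℂ} (hA : IsThermalState γA) (hB : IsThermalState γB) :
    (γA ⊗ₖ γB).IsHermitian := by
  rw [Matrix.IsHermitian, Matrix.conjTranspose_kronecker, hA.1.1, hB.1.1]

end Athermality

end

/-!
# Signalling and athermality of quantum channels

Write `g` for the smallest eigenvalue of `γA ⊗ γB`, `d = dim(A)`, `R = R(Λ‖Γ)`, `t = R_T(Λ)` and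
`s = R_S(Λ)`. Through Choi's theorem (`isCompletelyPositive_iff_choi`) the order on maps becomes the
positive semidefinite order on Choi matrices. The Choi matrices of Gibbs-preserving operations, like
the states of `B`, are positive semidefinite of fixed trace and hence form compact sets, so the
minima are attained (`isLeast_sInf_of_isCompact`). Since `Γ` is both Gibbs-preserving and
non-signalling, `t ≤ R` and `s ≤ R`.

The lower bound on `s` needs no entropic (Pinsker-type) inequality. The partial trace of
`γA ⊗ γB ≥ g 1` over `A` is `γB ≥ g d 1` (`posSemidef_sub_minEigenvalue_kronecker`), and this has
two consequences.

* If `Λ ≤ (1 + t) G` and `Λ ≤ (1 + s) Φ_σ` are optimal, then evaluating at `γA` gives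
  `Λ(γA) ≤ (1 + t) γB`, and shows that `(1 + s) σ - Λ(γA)` is positive semidefinite of trace `s`, so
  at most `s 1 ≤ (s / (g d)) γB`. Hence `(1 + s) σ ≤ (1 + t + s / (g d)) γB`, that is
  `g d (R - t) ≤ s` (`jointRobustness_le`).
* The Choi matrix of `Λ` has trace `d`, so it is at most `d 1 ≤ g⁻¹ (1 ⊗ γB)`, whence `g R ≤ 1`
  (`inv_sub_one_mem_feasible`).

For `d ≥ 2` the two combine to `2 (g (R - t))² ≤ 2 g (R - t) ≤ s`
(`two_mul_sq_le_signallingRobustness`); for `d = 1` every channel is non-signalling, so `s = 0` and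
the first bound gives `R = t`. The statement about `G ∈ GPO` is the case `t = 0`.
-/

noncomputable section

namespace Athermality

/-! ### Positive semidefinite matrices -/

section PosSemidef

variable {A B n : Type*}

/-- The matrix `c 1 + d M` has eigenvalues `c + d λᵢ`. -/
lemma posSemidef_smul_one_add_smul [Fintype n] [DecidableEq n] {M : Matrix n n ℂ}
    (hM : M.IsHermitian)
    (c d : ℝ) (h : ∀ i, 0 ≤ c + d * hM.eigenvalues i) :
    ((c : ℂ) • (1 : Matrix n n ℂ) + (d : ℂ) • M).PosSemidef := by
  have key : (c : ℂ) • (1 : Matrix n n ℂ) + (d : ℂ) • M =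
      Unitary.conjStarAlgAut ℂ _ hM.eigenvectorUnitary
        ((c : ℂ) • 1 + (d : ℂ) • Matrix.diagonal (RCLike.ofReal ∘ hM.eigenvalues)) := by
    conv_lhs => rw [hM.spectral_theorem]
    simp only [map_add, map_smul, map_one]
  rw [key, Unitary.conjStarAlgAut_apply]
  refine Matrix.PosSemidef.mul_mul_conjTranspose_same ?_ _
  have : (c : ℂ) • (1 : Matrix n n ℂ) + (d : ℂ) • Matrix.diagonal (RCLike.ofReal ∘ hM.eigenvalues)
      = Matrix.diagonal (fun i => ((c + d * hM.eigenvalues i : ℝ) : ℂ)) := by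
    ext i j
    by_cases hij : i = j <;> simp [hij]
  rw [this]
  exact Matrix.PosSemidef.diagonal fun i => by
    simpa only [Pi.zero_apply, Complex.zero_le_real] using h i

lemma posSemidef_sub_minEigenvalue [Fintype n] [DecidableEq n] {M : Matrix n n ℂ}
    (hM : M.IsHermitian) :
    (M - (minEigenvalue hM : ℂ) • (1 : Matrix n n ℂ)).PosSemidef := by
  have h := posSemidef_smul_one_add_smul hM (-minEigenvalue hM) 1 fun i => by
    have : minEigenvalue hM ≤ hM.eigenvalues i := ciInf_le (Set.finite_range _).bddBelow i
    linarith
  convert h using 1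
  push_cast
  module

lemma posSemidef_trace_smul_one_sub [Fintype n] [DecidableEq n] {M : Matrix n n ℂ}
    (hM : M.PosSemidef) :
    (M.trace • (1 : Matrix n n ℂ) - M).PosSemidef := by
  have h := posSemidef_smul_one_add_smul hM.1 (∑ i, hM.1.eigenvalues i) (-1) fun i => by
    have := Finset.single_le_sum (fun j _ => hM.eigenvalues_nonneg j) (Finset.mem_univ i)
    linarith
  convert h using 1
  rw [hM.1.trace_eq_sum_eigenvalues]
  push_cast
  simp only [Complex.coe_algebraMap]
  module

lemma minEigenvalue_pos [Fintype n] [DecidableEq n] [Nonempty n] {M : Matrix n n ℂ} (hM : M.PosDef)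
    (hM' : M.IsHermitian) : 0 < minEigenvalue hM' := by
  obtain ⟨i, hi⟩ := exists_eq_ciInf_of_finite (f := hM'.eigenvalues)
  rw [minEigenvalue, ← hi]
  exact hM.eigenvalues_pos i

/-- The partial trace over the first factor preserves positivity. -/
lemma posSemidef_partialTrace [Fintype A] {X : Matrix (A × B) (A × B) ℂ} (hX : X.PosSemidef) :
    (Matrix.of fun b b' => ∑ a, X (a, b) (a, b')).PosSemidef := by
  have h := Matrix.posSemidef_sum Finset.univ
    fun (a : A) _ => hX.submatrix (fun b : B => (a, b))
  convert h using 1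
  ext b b'
  simp [Matrix.sum_apply]

/-- Summing a positive semidefinite matrix over a tensor factor, that is compressing it by
the all-ones vector of that factor, preserves positivity. -/
lemma posSemidef_sum_sum [Fintype A] [Fintype n] {X : Matrix (n × A) (n × A) ℂ}
    (hX : X.PosSemidef) :
    (Matrix.of fun p q => ∑ a, ∑ a', X (p, a) (q, a')).PosSemidef := by
  classical
  have h := hX.conjTranspose_mul_mul_same
    (Matrix.of fun (u : n × A) (q : n) => if u.1 = q then (1 : ℂ) else 0)
  have hs : ∀ (f : n → A → ℂ) (q : n),
      (∑ x, ∑ y, if x = q then f x y else 0) = ∑ y, f q y := fun f q => by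
    rw [Finset.sum_comm]
    simp
  convert h using 1
  ext p q
  simp only [Matrix.of_apply, Matrix.mul_apply, Matrix.conjTranspose_apply,
    Fintype.sum_prod_type, apply_ite star, star_one, star_zero, ite_mul, one_mul, zero_mul,
    mul_ite, mul_one, mul_zero, hs]
  exact Finset.sum_comm

lemma posSemidef_sub_trans {M N P : Matrix n n ℂ} (h₁ : (N - M).PosSemidef)
    (h₂ : (P - N).PosSemidef) : (P - M).PosSemidef := by
  simpa using h₂.add h₁

/-- The principal `2 × 2` minors give `‖M i j‖² ≤ M i i * M j j`. -/
lemma norm_apply_le_trace [Fintype n] {M : Matrix n n ℂ} (hM : M.PosSemidef) (i j : n) :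
    ‖M i j‖ ≤ M.trace.re := by
  classical
  have hd : ∀ k, 0 ≤ (M k k).re := fun k => (Complex.le_def.1 (hM.diag_nonneg (i := k))).1
  have hdi : ∀ k, (M k k).im = 0 := fun k => (Complex.le_def.1 (hM.diag_nonneg (i := k))).2.symm
  have hle : ∀ k, (M k k).re ≤ M.trace.re := fun k => by
    rw [Matrix.trace, Complex.re_sum]
    exact Finset.single_le_sum (f := fun k => (M k k).re) (fun l _ => hd l) (Finset.mem_univ k)
  have hdet := (hM.submatrix ![i, j]).det_nonneg
  rw [Matrix.det_fin_two] at hdet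
  have hji : M j i = star (M i j) := (hM.1.apply j i).symm
  simp only [Matrix.submatrix_apply, Matrix.cons_val_zero, Matrix.cons_val_one, hji] at hdet
  have h2 := (Complex.le_def.1 hdet).1
  simp only [Complex.zero_re, Complex.sub_re, Complex.mul_re, hdi, RCLike.star_def, Complex.conj_re,
    Complex.conj_im] at h2
  have h3 : ‖M i j‖ ^ 2 ≤ M.trace.re ^ 2 := by
    rw [← Complex.normSq_eq_norm_sq, Complex.normSq_apply]
    nlinarith [mul_le_mul (hle i) (hle j) (hd j) ((hd i).trans (hle i))]
  exact (sq_le_sq₀ (norm_nonneg _) ((hd i).trans (hle i))).1 h3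

lemma isClosed_posSemidef [Fintype n] : IsClosed {M : Matrix n n ℂ | M.PosSemidef} := by
  simp only [Matrix.posSemidef_iff_dotProduct_mulVec, Matrix.IsHermitian, Set.ofPred_and,
    Set.ofPred_forall]
  refine (isClosed_eq (by fun_prop) continuous_id).inter (isClosed_iInter fun x => ?_)
  exact isClosed_le continuous_const (by fun_prop)

/-- Positive semidefinite matrices of a given trace have bounded entries, so a closed set of
them is compact. -/
lemma isCompact_of_posSemidef_trace [Fintype n] {K : Set (Matrix n n ℂ)} (c : ℂ) (hK : IsClosed K)
    (h : ∀ M ∈ K, M.PosSemidef ∧ M.trace = c) : IsCompact K := by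
  refine IsCompact.of_isClosed_subset (s := Set.univ.pi fun _ => Set.univ.pi fun _ =>
    Metric.closedBall (0 : ℂ) c.re) ?_ hK ?_
  · exact isCompact_univ_pi fun _ => isCompact_univ_pi fun _ => isCompact_closedBall _ _
  · intro M hM i _ j _
    rw [mem_closedBall_zero_iff, ← (h M hM).2]
    exact norm_apply_le_trace (h M hM).1 i j

end PosSemidef

/-! ### The Choi matrix -/

section Choi

variable {A B : Type*}

/-- The Choi matrix `∑ᵢⱼ |i⟩⟨j| ⊗ Φ(|i⟩⟨j|)`, left unnormalised. -/
def choi [DecidableEq A] (Φ : Matrix A A ℂ →ₗ[ℂ] Matrix B B ℂ) : Matrix (A × B) (A × B) ℂ :=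
  Matrix.of fun p q => Φ (Matrix.single p.1 q.1 1) p.2 q.2

/-- The linear map with a given Choi matrix. -/
def ofChoi [Fintype A] (J : Matrix (A × B) (A × B) ℂ) : Matrix A A ℂ →ₗ[ℂ] Matrix B B ℂ where
  toFun X := Matrix.of fun b b' => ∑ a, ∑ a', X a a' * J (a, b) (a', b')
  map_add' X Y := by
    ext; simp [add_mul, Finset.sum_add_distrib]
  map_smul' c X := by
    ext; simp [Finset.mul_sum, mul_assoc]

lemma apply_eq_sum_choi [Fintype A] [DecidableEq A] (Φ : Matrix A A ℂ →ₗ[ℂ] Matrix B B ℂ)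
    (X : Matrix A A ℂ) (b b' : B) :
    Φ X b b' = ∑ a, ∑ a', X a a' * choi Φ (a, b) (a', b') := by
  conv_lhs => rw [Matrix.matrix_eq_sum_single X]
  simp only [map_sum, Matrix.sum_apply]
  refine Finset.sum_congr rfl fun a _ => Finset.sum_congr rfl fun a' _ => ?_
  have : Matrix.single a a' (X a a') = X a a' • Matrix.single a a' (1 : ℂ) := by
    simp [Matrix.smul_single]
  rw [this, map_smul]
  rfl

lemma ofChoi_choi [Fintype A] [DecidableEq A] (Φ : Matrix A A ℂ →ₗ[ℂ] Matrix B B ℂ) :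
    ofChoi (choi Φ) = Φ := by
  refine LinearMap.ext fun X => ?_
  ext b b'
  exact (apply_eq_sum_choi Φ X b b').symm

lemma choi_ofChoi [Fintype A] [DecidableEq A] (J : Matrix (A × B) (A × B) ℂ) :
    choi (ofChoi J) = J := by
  ext ⟨a, b⟩ ⟨a', b'⟩
  simp only [choi, ofChoi, Matrix.of_apply, LinearMap.coe_mk, AddHom.coe_mk, Matrix.single_apply]
  rw [Finset.sum_eq_single a, Finset.sum_eq_single a'] <;> simp +contextual [eq_comm]

lemma choi_sub [DecidableEq A] (Φ Ψ : Matrix A A ℂ →ₗ[ℂ] Matrix B B ℂ) :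
    choi (Φ - Ψ) = choi Φ - choi Ψ := rfl

lemma choi_smul [DecidableEq A] (c : ℂ) (Φ : Matrix A A ℂ →ₗ[ℂ] Matrix B B ℂ) :
    choi (c • Φ) = c • choi Φ := rfl

lemma choi_traceReplace [Fintype A] [DecidableEq A] (σ : Matrix B B ℂ) :
    choi (traceReplace A σ) = (1 : Matrix A A ℂ) ⊗ₖ σ := by
  ext ⟨a, b⟩ ⟨a', b'⟩
  by_cases h : a = a' <;> simp [choi, traceReplace, h]

lemma trace_choi [Fintype A] [DecidableEq A] [Fintype B] {Φ : Matrix A A ℂ →ₗ[ℂ] Matrix B B ℂ}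
    (h : ∀ X, (Φ X).trace = X.trace) :
    (choi Φ).trace = Fintype.card A := by
  have h' : ∀ a : A, ∑ b, Φ (Matrix.single a a 1) b b = 1 := fun a => by
    simpa [Matrix.trace] using h (Matrix.single a a 1)
  simp [Matrix.trace, Fintype.sum_prod_type, choi, h']

/-- Choi's theorem. If the Choi matrix is positive semidefinite, then `id ⊗ Φ` applied to `X` is the
Schur product of blow-ups of `X` and of the Choi matrix, summed over the input system. -/
theorem isCompletelyPositive_iff_choi [Fintype A] [DecidableEq A] [Fintype B]
    (Φ : Matrix A A ℂ →ₗ[ℂ] Matrix B B ℂ) :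
    IsCompletelyPositive Φ ↔ (choi Φ).PosSemidef := by
  constructor
  · intro h
    let e := Fintype.equivFin A
    -- The unnormalised maximally entangled vector, the ancilla being a copy of the input.
    let v : Fin (Fintype.card A) × A → ℂ := fun p => if p.1 = e p.2 then 1 else 0
    have hv := (h _ _ (Matrix.posSemidef_vecMulVec_self_star v)).submatrix
      (fun p : A × B => (e p.1, p.2))
    convert hv using 1
    ext ⟨a, b⟩ ⟨a', b'⟩
    simp only [choi, ampliate, Matrix.of_apply, Matrix.submatrix_apply]
    refine congrArg (fun Y => Φ Y b b') ?_
    ext i j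
    by_cases hi : a = i <;> by_cases hj : a' = j <;>
      simp [v, Matrix.vecMulVec_apply, hi, hj]
  · intro h k X hX
    have hH := posSemidef_sum_sum (n := Fin k × B) (A := A)
      ((hX.submatrix (fun u : (Fin k × B) × A => (u.1.1, u.2))).hadamard
        (h.submatrix (fun u : (Fin k × B) × A => (u.2, u.1.2))))
    convert hH using 1
    ext p q
    simp only [ampliate, Matrix.of_apply, apply_eq_sum_choi, Matrix.hadamard_apply,
      Matrix.submatrix_apply]

lemma IsCompletelyPositive.posSemidef_apply {Φ : Matrix A A ℂ →ₗ[ℂ] Matrix B B ℂ}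
    (h : IsCompletelyPositive Φ) {X : Matrix A A ℂ} (hX : X.PosSemidef) : (Φ X).PosSemidef :=
  (h 1 _ (hX.submatrix (fun p : Fin 1 × A => p.2))).submatrix (fun b : B => (0, b))

lemma cple_iff_choi [Fintype A] [DecidableEq A] [Fintype B]
    (Φ Ψ : Matrix A A ℂ →ₗ[ℂ] Matrix B B ℂ) (c : ℂ) :
    CPLE Φ (c • Ψ) ↔ (c • choi Ψ - choi Φ).PosSemidef := by
  rw [CPLE, isCompletelyPositive_iff_choi, choi_sub, choi_smul]

/-- If `Φ ≤ c Φ_σ` and `c σ ≤ d τ`, then `Φ ≤ d Φ_τ`, where `Φ_σ(X) = Tr(X) σ`. -/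
lemma cple_traceReplace_trans [Fintype A] [DecidableEq A] [Fintype B]
    {Φ : Matrix A A ℂ →ₗ[ℂ] Matrix B B ℂ} {c d : ℂ}
    {σ τ : Matrix B B ℂ} (h : CPLE Φ (c • traceReplace A σ))
    (hστ : (d • τ - c • σ).PosSemidef) : CPLE Φ (d • traceReplace A τ) := by
  rw [cple_iff_choi, choi_traceReplace] at h ⊢
  refine posSemidef_sub_trans h ?_
  have key : d • (1 : Matrix A A ℂ) ⊗ₖ τ - c • (1 : Matrix A A ℂ) ⊗ₖ σ
      = (1 : Matrix A A ℂ) ⊗ₖ (d • τ - c • σ) := by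
    ext ⟨a, b⟩ ⟨a', b'⟩
    simp [mul_sub, mul_left_comm]
  rw [key]
  exact Matrix.PosSemidef.one.kronecker hστ

end Choi

/-! ### Feasible points and a compactness principle -/

section Minima

variable {A B : Type*}

/-- If `Λ ≤ (1 + s) Z` and both maps preserve the trace, then comparing the traces of the two
outputs for one state gives `0 ≤ s`. -/
lemma nonneg_of_cple [Fintype A] [Fintype B] {Λ Z : Matrix A A ℂ →ₗ[ℂ] Matrix B B ℂ}
    {γ : Matrix A A ℂ} (hγ : IsState γ)
    (hΛ : ∀ X, (Λ X).trace = X.trace) (hZ : ∀ X, (Z X).trace = X.trace) {s : ℝ}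
    (h : CPLE Λ (((1 + s : ℝ) : ℂ) • Z)) : 0 ≤ s := by
  have h1 := (h.posSemidef_apply hγ.1).trace_nonneg
  rw [LinearMap.sub_apply, LinearMap.smul_apply, Matrix.trace_sub, Matrix.trace_smul, hΛ, hZ,
    hγ.2] at h1
  simpa using (Complex.le_def.1 h1).1

/-- A minimum over `s` and a compact family of free operations is attained: an a priori bound
`s ≤ C` confines the minimisation to a compact set. -/
lemma isLeast_sInf_of_isCompact [Fintype A] [Fintype B] {T : Type*} [TopologicalSpace T]
    {K : Set T} (hK : IsCompact K)
    {f : T → Matrix (A × B) (A × B) ℂ} (hf : Continuous f)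
    {J : Matrix (A × B) (A × B) ℂ} {S : Set ℝ}
    (hS : ∀ s, s ∈ S ↔ ∃ m ∈ K, (((1 + s : ℝ) : ℂ) • f m - J).PosSemidef)
    (hne : S.Nonempty) (h0 : ∀ s ∈ S, 0 ≤ s) : IsLeast S (sInf S) := by
  obtain ⟨C, hC⟩ := hne
  let Q : Set (ℝ × T) := (Set.Icc 0 C ×ˢ K) ∩
    (fun x => ((1 + x.1 : ℝ) : ℂ) • f x.2 - J) ⁻¹' {M | M.PosSemidef}
  have hQ : IsCompact Q := (isCompact_Icc.prod hK).inter_right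
    (isClosed_posSemidef.preimage (by fun_prop))
  have hmem : ∀ s ∈ S, s ≤ C → s ∈ Prod.fst '' Q := fun s hs hsC => by
    obtain ⟨m, hm, hp⟩ := (hS s).1 hs
    exact ⟨(s, m), ⟨⟨⟨h0 s hs, hsC⟩, hm⟩, hp⟩, rfl⟩
  obtain ⟨l, ⟨x, hx, rfl⟩, hl⟩ := (hQ.image continuous_fst).exists_isLeast ⟨C, hmem C hC le_rfl⟩
  have hleast : IsLeast S x.1 := by
    refine ⟨(hS _).2 ⟨x.2, hx.1.2, hx.2⟩, fun s hs => ?_⟩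
    rcases le_total s C with h | h
    · exact hl (hmem s hs h)
    · exact hx.1.1.2.trans h
  rwa [hleast.csInf_eq]

lemma trace_traceReplace [Fintype A] [Fintype B] {σ : Matrix B B ℂ} (hσ : σ.trace = 1)
    (X : Matrix A A ℂ) :
    (traceReplace A σ X).trace = X.trace := by
  simp [traceReplace, hσ]

lemma isChannel_traceReplace [Fintype A] [DecidableEq A] [Fintype B] {σ : Matrix B B ℂ}
    (hσ : IsState σ) :
    IsChannel (traceReplace A σ) := by
  refine ⟨?_, trace_traceReplace hσ.2⟩
  rw [isCompletelyPositive_iff_choi, choi_traceReplace]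
  exact Matrix.PosSemidef.one.kronecker hσ.1

lemma IsThermalState.isState [Fintype A] {γ : Matrix A A ℂ} (h : IsThermalState γ) : IsState γ :=
  ⟨h.1.posSemidef, h.2⟩

lemma thermalising_mem_GPO [Fintype A] [DecidableEq A] [Fintype B] {γA : Matrix A A ℂ}
    {γB : Matrix B B ℂ} (hA : IsThermalState γA)
    (hB : IsThermalState γB) : thermalising A γB ∈ GPO γA γB :=
  ⟨isChannel_traceReplace ⟨hB.1.posSemidef, hB.2⟩, by simp [thermalising, traceReplace, hA.2]⟩

lemma nonempty_of_isState [Fintype A] {γ : Matrix A A ℂ} (h : IsState γ) : Nonempty A := by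
  by_contra hA
  rw [not_nonempty_iff] at hA
  simpa [Matrix.trace] using h.2

lemma zero_mem_feasibleFree {F : Set (Matrix A A ℂ →ₗ[ℂ] Matrix B B ℂ)}
    {Λ : Matrix A A ℂ →ₗ[ℂ] Matrix B B ℂ} (hΛ : Λ ∈ F) : 0 ∈ feasibleFree F Λ := by
  refine ⟨Λ, hΛ, ?_⟩
  intro k X _
  simpa [ampliate] using! Matrix.PosSemidef.zero

/-- A channel with a one-dimensional input is a preparation, hence does not signal. -/
lemma mem_NSO_of_unique [Fintype A] [DecidableEq A] [Fintype B] [Unique A]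
    {Λ : Matrix A A ℂ →ₗ[ℂ] Matrix B B ℂ} (hΛ : IsChannel Λ) :
    Λ ∈ NSO A B := by
  refine ⟨Λ 1, ⟨hΛ.1.posSemidef_apply Matrix.PosSemidef.one, by simp [hΛ.2]⟩, ?_⟩
  refine LinearMap.ext fun X => ?_
  have hX : X = X.trace • (1 : Matrix A A ℂ) := by
    ext i j
    simp [Matrix.trace, Subsingleton.elim i default, Subsingleton.elim j default]
  conv_lhs => rw [hX, map_smul]
  rfl

end Minima

/-! ### Attainment of the three minima -/

section Attainment

variable {A B : Type*} [Fintype A] [DecidableEq A] [Fintype B]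

/-- `γB ≥ g dim(A) 1` with `g` the smallest eigenvalue of `γA ⊗ γB`: take the partial trace over
`A` of `γA ⊗ γB ≥ g 1`. -/
lemma posSemidef_sub_minEigenvalue_kronecker [DecidableEq B] {γA : Matrix A A ℂ}
    {γB : Matrix B B ℂ} (hA : IsThermalState γA) (hB : IsThermalState γB) :
    (γB - ((minEigenvalue (hA.kronecker_isHermitian hB) * Fintype.card A : ℝ) : ℂ) •
      (1 : Matrix B B ℂ)).PosSemidef := by
  have h := posSemidef_partialTrace (posSemidef_sub_minEigenvalue (hA.kronecker_isHermitian hB))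
  convert h using 1
  ext b b'
  have hs : ∑ a, γA a a = 1 := hA.2
  by_cases hb : b = b' <;>
    simp [Matrix.one_apply, hb, Finset.sum_sub_distrib, ← Finset.sum_mul, hs, mul_comm]

/-- For positive semidefinite `M`, `M ≤ Tr(M) 1 ≤ Tr(M) / (g dim(A)) γB`. -/
lemma posSemidef_smul_thermal_sub [DecidableEq B] {γA : Matrix A A ℂ}
    {γB : Matrix B B ℂ} (hA : IsThermalState γA) (hB : IsThermalState γB)
    (hg : 0 < minEigenvalue (hA.kronecker_isHermitian hB) * Fintype.card A)
    {M : Matrix B B ℂ} (hM : M.PosSemidef) {s : ℝ} (hs : M.trace = s) :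
    (((s / (minEigenvalue (hA.kronecker_isHermitian hB) * Fintype.card A) : ℝ) : ℂ) • γB
      - M).PosSemidef := by
  set c : ℝ := minEigenvalue (hA.kronecker_isHermitian hB) * Fintype.card A with hc
  have hs0 : 0 ≤ s := by
    have := hM.trace_nonneg
    rw [hs] at this
    exact_mod_cast this
  have h1 : (((s / c : ℝ) : ℂ) • (γB - (c : ℂ) • (1 : Matrix B B ℂ))).PosSemidef :=
    (posSemidef_sub_minEigenvalue_kronecker hA hB).smul
      (Complex.zero_le_real.2 (div_nonneg hs0 hg.le))
  have h2 := posSemidef_trace_smul_one_sub hM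
  rw [hs] at h2
  have h3 : ((s / c : ℝ) : ℂ) * c = s := by
    rw [← Complex.ofReal_mul, div_mul_cancel₀ _ hg.ne']
  rw [smul_sub, smul_smul, h3] at h1
  exact posSemidef_sub_trans h2 h1

lemma minEigenvalue_kronecker_pos [DecidableEq B] {γA : Matrix A A ℂ}
    {γB : Matrix B B ℂ} (hA : IsThermalState γA) (hB : IsThermalState γB) :
    0 < minEigenvalue (hA.kronecker_isHermitian hB) := by
  have := nonempty_of_isState hA.isState
  have := nonempty_of_isState (γ := γB) hB.isState
  refine minEigenvalue_pos ?_ _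
  exact hA.1.kronecker hB.1

/-- `R(Λ‖Γ) ≤ g⁻¹ - 1`: the Choi matrix of a channel has trace `dim(A)`, so it is at most
`dim(A) 1`, which is at most `g⁻¹ (1 ⊗ γB)`. In particular all three feasible sets are nonempty. -/
lemma inv_sub_one_mem_feasible [DecidableEq B] {γA : Matrix A A ℂ}
    {γB : Matrix B B ℂ} (hA : IsThermalState γA) (hB : IsThermalState γB)
    {Λ : Matrix A A ℂ →ₗ[ℂ] Matrix B B ℂ} (hΛ : IsChannel Λ) :
    (minEigenvalue (hA.kronecker_isHermitian hB))⁻¹ - 1 ∈ feasible Λ (thermalising A γB) := by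
  have hg := minEigenvalue_kronecker_pos hA hB
  set g := minEigenvalue (hA.kronecker_isHermitian hB) with hgdef
  have h1 := posSemidef_trace_smul_one_sub ((isCompletelyPositive_iff_choi Λ).1 hΛ.1)
  rw [trace_choi hΛ.2] at h1
  rw [feasible, Set.mem_ofPred_eq, add_sub_cancel]
  have h2 : CPLE Λ ((Fintype.card A : ℂ) • traceReplace A 1) := by
    rw [cple_iff_choi, choi_traceReplace, Matrix.one_kronecker_one]
    exact h1
  refine cple_traceReplace_trans h2 ?_
  have h3 : (((g⁻¹ : ℝ) : ℂ) • (γB - ((g * Fintype.card A : ℝ) : ℂ) •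
      (1 : Matrix B B ℂ))).PosSemidef :=
    (posSemidef_sub_minEigenvalue_kronecker hA hB).smul
      (Complex.zero_le_real.2 (inv_nonneg.2 hg.le))
  rw [smul_sub, smul_smul, ← Complex.ofReal_mul, inv_mul_cancel_left₀ hg.ne',
    Complex.ofReal_natCast] at h3
  exact h3

lemma isLeast_jointRobustness [DecidableEq B] {γA : Matrix A A ℂ}
    {γB : Matrix B B ℂ} (hA : IsThermalState γA) (hB : IsThermalState γB)
    {Λ : Matrix A A ℂ →ₗ[ℂ] Matrix B B ℂ} (hΛ : IsChannel Λ) :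
    IsLeast (feasible Λ (thermalising A γB)) (jointRobustness γB Λ) :=
  isLeast_sInf_of_isCompact (K := {()}) isCompact_singleton
    (f := fun _ => choi (thermalising A γB)) (J := choi Λ) continuous_const
    (fun s => (cple_iff_choi Λ _ _).trans (by simp))
    ⟨_, inv_sub_one_mem_feasible hA hB hΛ⟩
    (fun _ hs => nonneg_of_cple hA.isState hΛ.2 (trace_traceReplace hB.2) hs)

lemma isCompact_isState : IsCompact {σ : Matrix B B ℂ | IsState σ} := by
  refine isCompact_of_posSemidef_trace 1 ?_ fun σ hσ => hσ
  exact isClosed_posSemidef.inter (isClosed_eq (by fun_prop) continuous_const)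

lemma isLeast_signallingRobustness [DecidableEq B] {γA : Matrix A A ℂ}
    {γB : Matrix B B ℂ} (hA : IsThermalState γA) (hB : IsThermalState γB)
    {Λ : Matrix A A ℂ →ₗ[ℂ] Matrix B B ℂ} (hΛ : IsChannel Λ) :
    IsLeast (feasibleFree (NSO A B) Λ) (signallingRobustness Λ) := by
  refine isLeast_sInf_of_isCompact isCompact_isState
    (f := fun σ => choi (traceReplace A σ)) (J := choi Λ) ?_ (fun s => ?_)
    ⟨_, _, ⟨γB, hB.isState, rfl⟩, inv_sub_one_mem_feasible hA hB hΛ⟩ ?_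
  · simp only [choi_traceReplace]
    refine continuous_matrix fun p q => ?_
    simp only [Matrix.kroneckerMap_apply]
    fun_prop
  · constructor
    · rintro ⟨_, ⟨σ, hσ, rfl⟩, h⟩
      exact ⟨σ, hσ, (cple_iff_choi _ _ _).1 h⟩
    · rintro ⟨σ, hσ, h⟩
      exact ⟨_, ⟨σ, hσ, rfl⟩, (cple_iff_choi _ _ _).2 h⟩
  · rintro s ⟨_, ⟨σ, hσ, rfl⟩, h⟩
    exact nonneg_of_cple hA.isState hΛ.2 (trace_traceReplace hσ.2) h

/-- The Choi matrices of the Gibbs-preserving operations form a compact set. -/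
lemma isCompact_choi_GPO (γA : Matrix A A ℂ) (γB : Matrix B B ℂ) :
    IsCompact {J : Matrix (A × B) (A × B) ℂ | ofChoi J ∈ GPO γA γB} := by
  have hcont : ∀ X : Matrix A A ℂ,
      Continuous fun J : Matrix (A × B) (A × B) ℂ => ofChoi J X := fun X =>
    continuous_matrix fun b b' => by
      simp only [ofChoi, LinearMap.coe_mk, AddHom.coe_mk, Matrix.of_apply]
      fun_prop
  refine isCompact_of_posSemidef_trace (Fintype.card A) ?_ fun J hJ => ?_
  · have hmem : ∀ J : Matrix (A × B) (A × B) ℂ, ofChoi J ∈ GPO γA γB ↔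
        (J.PosSemidef ∧ ∀ X, (ofChoi J X).trace = X.trace) ∧ ofChoi J γA = γB := fun J => by
      rw [GPO, Set.mem_ofPred_eq, IsChannel, isCompletelyPositive_iff_choi, choi_ofChoi]
    simp only [hmem, Set.ofPred_and, Set.ofPred_forall]
    exact (isClosed_posSemidef.inter (isClosed_iInter fun X =>
      isClosed_eq (hcont X).matrix_trace continuous_const)).inter
      (isClosed_eq (hcont γA) continuous_const)
  · have h1 := (isCompletelyPositive_iff_choi _).1 hJ.1.1
    have h2 := trace_choi hJ.1.2
    rw [choi_ofChoi] at h1 h2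
    exact ⟨h1, h2⟩

lemma isLeast_athermalityRobustness [DecidableEq B] {γA : Matrix A A ℂ}
    {γB : Matrix B B ℂ} (hA : IsThermalState γA) (hB : IsThermalState γB)
    {Λ : Matrix A A ℂ →ₗ[ℂ] Matrix B B ℂ} (hΛ : IsChannel Λ) :
    IsLeast (feasibleFree (GPO γA γB) Λ) (athermalityRobustness γA γB Λ) := by
  refine isLeast_sInf_of_isCompact (isCompact_choi_GPO γA γB)
    (f := id) (J := choi Λ) continuous_id (fun s => ?_)
    ⟨_, _, thermalising_mem_GPO hA hB, inv_sub_one_mem_feasible hA hB hΛ⟩ ?_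
  · constructor
    · rintro ⟨G, hG, h⟩
      refine ⟨choi G, ?_, (cple_iff_choi _ _ _).1 h⟩
      rwa [Set.mem_ofPred_eq, ofChoi_choi]
    · rintro ⟨J, hJ, h⟩
      refine ⟨ofChoi J, hJ, (cple_iff_choi _ _ _).2 ?_⟩
      rwa [choi_ofChoi]
  · rintro s ⟨G, hG, h⟩
    exact nonneg_of_cple hA.isState hΛ.2 hG.1.2 h

end Attainment

/-! ### The inequalities between the robustnesses -/

section Bounds

variable {A B : Type*} [Fintype A] [DecidableEq A] [Fintype B] [DecidableEq B]

/-- With `t = R_T(Λ)` and `s = R_S(Λ)`, one has `Λ(γA) ≤ (1 + t) γB`, while `(1 + s) σ - Λ(γA)` is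
positive semidefinite of trace `s`. Adding the two bounds gives `(1 + s) σ ≤ (1 + r) γB` for
`r = t + s / (g dim(A))`, so `Λ ≤ (1 + s) Φ_σ ≤ (1 + r) Γ`. -/
lemma jointRobustness_le {γA : Matrix A A ℂ}
    {γB : Matrix B B ℂ} (hA : IsThermalState γA) (hB : IsThermalState γB)
    {Λ : Matrix A A ℂ →ₗ[ℂ] Matrix B B ℂ} (hΛ : IsChannel Λ) :
    jointRobustness γB Λ ≤ athermalityRobustness γA γB Λ + signallingRobustness Λ /
      (minEigenvalue (hA.kronecker_isHermitian hB) * Fintype.card A) := by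
  have := nonempty_of_isState hA.isState
  have hg : 0 < minEigenvalue (hA.kronecker_isHermitian hB) * Fintype.card A :=
    mul_pos (minEigenvalue_kronecker_pos hA hB) (Nat.cast_pos.2 Fintype.card_pos)
  obtain ⟨G, hG, hΛG⟩ := (isLeast_athermalityRobustness hA hB hΛ).1
  obtain ⟨_, ⟨σ, hσ, rfl⟩, hΛσ⟩ := (isLeast_signallingRobustness hA hB hΛ).1
  set t := athermalityRobustness γA γB Λ
  set s := signallingRobustness Λ
  refine (isLeast_jointRobustness hA hB hΛ).2 ?_
  refine cple_traceReplace_trans hΛσ ?_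
  have h1 := hΛG.posSemidef_apply hA.1.posSemidef
  rw [LinearMap.sub_apply, LinearMap.smul_apply, hG.2] at h1
  have h2 := hΛσ.posSemidef_apply hA.1.posSemidef
  have h3 := posSemidef_smul_thermal_sub hA hB hg h2 (s := s) (by
    rw [LinearMap.sub_apply, LinearMap.smul_apply, Matrix.trace_sub, Matrix.trace_smul, hΛ.2,
      trace_traceReplace hσ.2, hA.2]
    simp)
  have h4 : traceReplace A σ γA = σ := by simp [traceReplace, hA.2]
  rw [LinearMap.sub_apply, LinearMap.smul_apply, h4] at h3
  convert h1.add h3 using 1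
  push_cast
  module

lemma signallingRobustness_le_jointRobustness {γA : Matrix A A ℂ}
    {γB : Matrix B B ℂ} (hA : IsThermalState γA) (hB : IsThermalState γB)
    {Λ : Matrix A A ℂ →ₗ[ℂ] Matrix B B ℂ} (hΛ : IsChannel Λ) :
    signallingRobustness Λ ≤ jointRobustness γB Λ :=
  (isLeast_signallingRobustness hA hB hΛ).2
    ⟨_, ⟨γB, hB.isState, rfl⟩, (isLeast_jointRobustness hA hB hΛ).1⟩

lemma athermalityRobustness_le_jointRobustness {γA : Matrix A A ℂ}
    {γB : Matrix B B ℂ} (hA : IsThermalState γA) (hB : IsThermalState γB)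
    {Λ : Matrix A A ℂ →ₗ[ℂ] Matrix B B ℂ} (hΛ : IsChannel Λ) :
    athermalityRobustness γA γB Λ ≤ jointRobustness γB Λ :=
  (isLeast_athermalityRobustness hA hB hΛ).2
    ⟨_, thermalising_mem_GPO hA hB, (isLeast_jointRobustness hA hB hΛ).1⟩

lemma athermalityRobustness_nonneg {γA : Matrix A A ℂ}
    {γB : Matrix B B ℂ} (hA : IsThermalState γA) (hB : IsThermalState γB)
    {Λ : Matrix A A ℂ →ₗ[ℂ] Matrix B B ℂ} (hΛ : IsChannel Λ) :
    0 ≤ athermalityRobustness γA γB Λ := by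
  obtain ⟨G, hG, h⟩ := (isLeast_athermalityRobustness hA hB hΛ).1
  exact nonneg_of_cple hA.isState hΛ.2 hG.1.2 h

/-- With `D = R(Λ‖Γ) - R_T(Λ)`, the bounds `g D dim(A) ≤ R_S(Λ)` and `g D ≤ 1` multiply to
`2 (g D)² ≤ R_S(Λ)` as soon as `dim(A) ≥ 2`. -/
lemma two_mul_sq_le_signallingRobustness {γA : Matrix A A ℂ}
    {γB : Matrix B B ℂ} (hA : IsThermalState γA) (hB : IsThermalState γB)
    {Λ : Matrix A A ℂ →ₗ[ℂ] Matrix B B ℂ} (hΛ : IsChannel Λ) :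
    2 * minEigenvalue (hA.kronecker_isHermitian hB) ^ 2 *
      (jointRobustness γB Λ - athermalityRobustness γA γB Λ) ^ 2 ≤ signallingRobustness Λ := by
  have := nonempty_of_isState hA.isState
  have hg := minEigenvalue_kronecker_pos hA hB
  have hd : 0 < Fintype.card A := Fintype.card_pos
  have hD := athermalityRobustness_le_jointRobustness hA hB hΛ
  have ht := athermalityRobustness_nonneg hA hB hΛ
  have hR := (isLeast_jointRobustness hA hB hΛ).2 (inv_sub_one_mem_feasible hA hB hΛ)
  have hU := jointRobustness_le hA hB hΛ
  have hNSO : Fintype.card A = 1 → signallingRobustness Λ ≤ 0 := fun h1 => by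
    have := (Fintype.card_eq_one_iff_nonempty_unique.1 h1).some
    exact (isLeast_signallingRobustness hA hB hΛ).2 (zero_mem_feasibleFree (mem_NSO_of_unique hΛ))
  set g := minEigenvalue (hA.kronecker_isHermitian hB)
  set R := jointRobustness γB Λ
  set t := athermalityRobustness γA γB Λ
  set s := signallingRobustness Λ
  have hdR : (0 : ℝ) < Fintype.card A := Nat.cast_pos.2 hd
  have hgD : g * (R - t) * Fintype.card A ≤ s := by
    rw [← sub_le_iff_le_add', le_div_iff₀ (mul_pos hg hdR)] at hU
    linarith
  have hgD1 : g * (R - t) ≤ 1 := by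
    have : g * (R - t) ≤ g * g⁻¹ := mul_le_mul_of_nonneg_left (by linarith) hg.le
    rwa [mul_inv_cancel₀ hg.ne'] at this
  have hgD0 : 0 ≤ g * (R - t) := mul_nonneg hg.le (sub_nonneg.2 hD)
  rw [mul_assoc, ← mul_pow]
  rcases (Nat.succ_le_of_lt hd).eq_or_lt with h1 | h2
  -- In dimension one `R_S(Λ) = 0`, which forces `D = 0`.
  · have hs := hNSO h1.symm
    rw [← h1] at hgD
    push_cast at hgD
    nlinarith
  · have h2' : (2 : ℝ) ≤ Fintype.card A := by exact_mod_cast h2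
    nlinarith [mul_le_mul_of_nonneg_left h2' hgD0, mul_le_mul_of_nonneg_left hgD1 hgD0]

end Bounds

end Athermality

end

/-- The first three conjuncts say that the minima defining `R(Λ‖Γ)`, `R_T(Λ)` and `R_S(Λ)` are
attained. -/
theorem theorem4 {A B : Type*} [Fintype A] [DecidableEq A] [Fintype B] [DecidableEq B]
    (γA : Matrix A A ℂ) (γB : Matrix B B ℂ)
    (hA : Athermality.IsThermalState γA) (hB : Athermality.IsThermalState γB) :
    (∀ Λ : Matrix A A ℂ →ₗ[ℂ] Matrix B B ℂ, Athermality.IsChannel Λ →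
      IsLeast (Athermality.feasible Λ (Athermality.thermalising A γB))
        (Athermality.jointRobustness γB Λ) ∧
      IsLeast (Athermality.feasibleFree (Athermality.GPO γA γB) Λ)
        (Athermality.athermalityRobustness γA γB Λ) ∧
      IsLeast (Athermality.feasibleFree (Athermality.NSO A B) Λ)
        (Athermality.signallingRobustness Λ) ∧
      Athermality.signallingRobustness Λ ≤ Athermality.jointRobustness γB Λ ∧
      2 * Athermality.minEigenvalue (hA.kronecker_isHermitian hB) ^ 2 *
          (Athermality.jointRobustness γB Λ - Athermality.athermalityRobustness γA γB Λ) ^ 2 ≤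
        Athermality.signallingRobustness Λ) ∧
    (∀ G : Athermality.GPO γA γB,
      Athermality.signallingRobustness G.1 ≤ Athermality.athermalityPreservability γA γB G ∧
      2 * Athermality.minEigenvalue (hA.kronecker_isHermitian hB) ^ 2 *
          Athermality.athermalityPreservability γA γB G ^ 2 ≤
        Athermality.signallingRobustness G.1) := by
  refine ⟨fun Λ hΛ => ⟨Athermality.isLeast_jointRobustness hA hB hΛ,
    Athermality.isLeast_athermalityRobustness hA hB hΛ,
    Athermality.isLeast_signallingRobustness hA hB hΛ,
    Athermality.signallingRobustness_le_jointRobustness hA hB hΛ,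
    Athermality.two_mul_sq_le_signallingRobustness hA hB hΛ⟩, fun G => ?_⟩
  have hG : Athermality.IsChannel G.1 := G.2.1
  refine ⟨Athermality.signallingRobustness_le_jointRobustness hA hB hG, ?_⟩
  have h0 : Athermality.athermalityRobustness γA γB G.1 = 0 :=
    le_antisymm ((Athermality.isLeast_athermalityRobustness hA hB hG).2
      (Athermality.zero_mem_feasibleFree G.2)) (Athermality.athermalityRobustness_nonneg hA hB hG)
  have h := Athermality.two_mul_sq_le_signallingRobustness hA hB hG
  rwa [h0, sub_zero] at h
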